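/- Conventions. Let $A\in\mathbb Z^{m\times d}$ with $\ker_{\mathbb Z}(A)\cap\mathbb N^d=\{0\}$ (where $0\in\mathbb N$), and let $\mathbb NA\subseteq\mathbb Z^m$ be the affine semigroup generated by the columns of $A$. For $b\in\mathbb Z^m$ let $\mathcal F_{A,b}=\{u\in\mathbb N^d: Au=b\}$, which is a finite set, and let $\mathcal R_{A,b}=\{x\in\mathbb Q_{\ge 0}^d: Ax=b\}$; the dimension of $\mathcal R_{A,b}$ is the dimension of its affine hull. For a finite set $\mathcal M\subset\mathbb Z^d$ write $\pm\mathcal M=\mathcal M\cup(-\mathcal M)$. The fiber graph $\mathcal F_{A,b}(\mathcal M)$ is the graph with node set $\mathcal F_{A,b}$ in which $u,v$ are adjacent if $u-v\in\pm\mathcal M$ and in which every node $w$ additionally gets one loop for every $e\in\pm\mathcal M$ with $w+e\notin\mathcal F_{A,b}$. A finite set $\mathcal M\subset\ker_{\mathbb Z}(A)$ is a Markov basis for $A$ if $\mathcal F_{A,b}(\mathcal M)$ is connected for all $b\in\mathbb NA$. The simple walk on a finite graph $G$ has transition probabilities $S^G_{vw}=(\text{number of edges between } v \text{ and } w)/\deg(v)$,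 where $\deg(v)$ is the number of edges incident to $v$ (a loop counts once). The second largest eigenvalue modulus of $S^G$ is the second entry of the decreasing list of the moduli of its eigenvalues, counted with multiplicity (and $0$ if $G$ has only one node). A sequence $(G_i)_{i\in\mathbb N}$ of finite non-empty graphs with node sets $V_i$, where $\lambda_i$ is the second largest eigenvalue modulus of $S^{G_i}$, is rapidly mixing if there is a polynomial $q\in\mathbb Q_{\ge0}[t]$ such that for all $i\in\mathbb N$, $q(\log|V_i|)>0$ and $\lambda_i\le 1-\frac{1}{q(\log|V_i|)}$. Statement. Let $\mathcal M\subset\ker_{\mathbb Z}(A)$ be a Markov basis for $A$ and let $b\in\mathbb NA$ with $\dim(\mathcal R_{A,b})>0$. Let $(b_i)_{i\in\mathbb N}$ be a sequence in $\mathbb NA$ that has $(p(k)\cdot b)_{k\in\mathbb N}$ as a subsequence for some non-constant polynomial $p\in\mathbb Q[t]$, that is, there are $i_0<i_1<i_2<\cdots$ in $\mathbb N$ with $b_{i_k}=p(k)\cdot b$ for all $k\in\mathbb N$. Then the sequence of fiber graphs $(\mathcal F_{A,b_i}(\mathcal M))_{i\in\mathbb N}$ is not rapidly mixing. -/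

import Mathlib

namespace FiberWalk

/-- A finite-type undirected graph with multiple edges and multiple loops, given by its adjacency
matrix: `mult v w` is the number of edges with endpoints `v` and `w`, and `mult v v` is the number
of loops at `v`. -/
structure Multigraph (V : Type) where
  mult : V → V → ℕ
  symm : ∀ v w, mult v w = mult w v

namespace Multigraph

variable {V : Type}

/-- Any two nodes are joined by a path, and there is at least one node. -/
def Connected (G : Multigraph V) : Prop :=
  Nonempty V ∧ ∀ v w, Relation.ReflTransGen (fun x y => 0 < G.mult x y) v w

/-- The number of edges incident to `v`; a loop counts once. -/
def degree [Fintype V] (G : Multigraph V) (v : V) : ℕ := ∑ w, G.mult v w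

/-- The transition matrix of the simple walk. -/
noncomputable def simpleWalk [Fintype V] (G : Multigraph V) : Matrix V V ℝ :=
  Matrix.of fun v w => (G.mult v w : ℝ) / (G.degree v : ℝ)

end Multigraph

/-- The second largest eigenvalue modulus of a real square matrix: list the moduli of its complex
eigenvalues, with multiplicity, in decreasing order and take the second entry. It is `0` if there
are fewer than two eigenvalues. -/
noncomputable def slem {V : Type} [Fintype V] [DecidableEq V] (S : Matrix V V ℝ) : ℝ :=
  (((S.map (fun x : ℝ => (x : ℂ))).charpoly.roots.map (fun z => ‖z‖)).sort (· ≥ ·)).getD 1 0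

/-- A sequence of finite graphs is rapidly mixing if for some polynomial `p` with nonnegative
rational coefficients, `λ_i ≤ 1 - 1 / p (log |V_i|)` for all `i`. The positivity of
`p (log |V_i|)` makes the quotient meaningful. -/
def RapidlyMixing {V : ℕ → Type} [∀ i, Fintype (V i)] [∀ i, DecidableEq (V i)]
    (G : ∀ i, Multigraph (V i)) : Prop :=
  ∃ p : Polynomial ℚ, (∀ n, 0 ≤ p.coeff n) ∧
    ∀ i, 0 < Polynomial.aeval (Real.log (Fintype.card (V i))) p ∧
      slem (G i).simpleWalk ≤ 1 - 1 / Polynomial.aeval (Real.log (Fintype.card (V i))) p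

/-- The set `±M`. -/
def plusMinus {d : ℕ} (M : Finset (Fin d → ℤ)) : Finset (Fin d → ℤ) :=
  M ∪ M.image (fun v => -v)

theorem neg_mem_plusMinus {d : ℕ} {M : Finset (Fin d → ℤ)} {v : Fin d → ℤ}
    (h : v ∈ plusMinus M) : -v ∈ plusMinus M := by
  simp only [plusMinus, Finset.mem_union, Finset.mem_image] at h ⊢
  rcases h with h | ⟨a, ha, rfl⟩
  · exact Or.inr ⟨v, h, rfl⟩
  · exact Or.inl (by simpa using ha)

/-- The fiber graph `F(M)`: nodes `u, v` are adjacent if `u - v ∈ ±M`, and every node `w` gets a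
loop for every `m ∈ ±M` with `w + m ∉ F`. -/
def fiberGraph {d : ℕ} (F M : Finset (Fin d → ℤ)) : Multigraph F where
  mult u v :=
    (if u.1 - v.1 ∈ plusMinus M then 1 else 0) +
      (if u = v then ((plusMinus M).filter (fun m => u.1 + m ∉ F)).card else 0)
  symm u v := by
    have h : (u.1 - v.1 ∈ plusMinus M) ↔ (v.1 - u.1 ∈ plusMinus M) :=
      ⟨fun h => by simpa using neg_mem_plusMinus h, fun h => by simpa using neg_mem_plusMinus h⟩
    by_cases huv : u = v
    · subst huv; rfl
    · simp only [h, huv, Ne.symm huv, if_false]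

variable {m d : ℕ}

/-- `ker_ℤ(A) ∩ ℕ^d = {0}`. -/
def TrivialNonnegKernel (A : Matrix (Fin m) (Fin d) ℤ) : Prop :=
  ∀ u : Fin d → ℤ, A.mulVec u = 0 → 0 ≤ u → u = 0

theorem fiber_finite (A : Matrix (Fin m) (Fin d) ℤ) (hA : TrivialNonnegKernel A)
    (b : Fin m → ℤ) : {u : Fin d → ℤ | 0 ≤ u ∧ A.mulVec u = b}.Finite := by
  have key : {u : Fin d → ℕ | A.mulVec (fun j => (u j : ℤ)) = b}.Finite := by
    have hanti : IsAntichain (· ≤ ·) {u : Fin d → ℕ | A.mulVec (fun j => (u j : ℤ)) = b} := by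
      intro u hu v hv hne hle
      apply hne
      have h0 := hA ((fun j => (v j : ℤ)) - fun j => (u j : ℤ))
        (by rw [Matrix.mulVec_sub, hu, hv, sub_self])
        (fun j => by simpa using hle j)
      funext j
      have := congrFun h0 j
      simp only [Pi.sub_apply, Pi.zero_apply] at this
      omega
    exact hanti.finite_of_partiallyWellOrderedOn (Set.isPWO_of_wellQuasiOrderedLE _)
  refine (key.image (fun u j => (u j : ℤ))).subset ?_
  rintro u ⟨hu0, hu⟩
  have : (fun j => (((u j).toNat : ℕ) : ℤ)) = u := funext fun j => Int.toNat_of_nonneg (hu0 j)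
  exact ⟨fun j => (u j).toNat, by simpa only [Set.mem_ofPred_eq, this] using hu, this⟩

/-- The fiber `{u ∈ ℕ^d : A u = b}`, as a finite subset of `ℤ^d`. -/
noncomputable def fiber (A : Matrix (Fin m) (Fin d) ℤ) (hA : TrivialNonnegKernel A)
    (b : Fin m → ℤ) : Finset (Fin d → ℤ) :=
  (fiber_finite A hA b).toFinset

/-- The affine semigroup `ℕA` generated by the columns of `A`. -/
def affineSemigroup (A : Matrix (Fin m) (Fin d) ℤ) : AddSubmonoid (Fin m → ℤ) :=
  AddSubmonoid.closure (Set.range fun j : Fin d => fun i : Fin m => A i j)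

/-- A finite set `M ⊆ ker_ℤ(A)` is a Markov basis for `A` if the fiber graph of every
`b ∈ ℕA` is connected. -/
def IsMarkovBasis (A : Matrix (Fin m) (Fin d) ℤ) (hA : TrivialNonnegKernel A)
    (M : Finset (Fin d → ℤ)) : Prop :=
  (∀ v ∈ M, A.mulVec v = 0) ∧
    ∀ b ∈ affineSemigroup A, (fiberGraph (fiber A hA b) M).Connected

/-- The `ℚ`-relaxation `{x ∈ ℚ_{≥0}^d : A x = b}` of the fiber. -/
def relaxedFiber (A : Matrix (Fin m) (Fin d) ℤ) (b : Fin m → ℤ) : Set (Fin d → ℚ) :=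
  {x | 0 ≤ x ∧ (A.map (fun z : ℤ => (z : ℚ))).mulVec x = fun i => (b i : ℚ)}

/-- The dimension of a set of rational points: the dimension of its affine hull. -/
noncomputable def affineDim (P : Set (Fin d → ℚ)) : ℕ :=
  Module.finrank ℚ (affineSpan ℚ P).direction

end FiberWalk

/-!
Let `P` be a symmetric stochastic matrix and `f` a function that changes by at most `K` along each
transition of `P`. Indicators of two sets of nodes that are far apart are orthogonal and not coupled
by `P`, so one of the sets must grow by a factor `1 / slem P` when it is enlarged by one step.
Applied to sublevel and superlevel sets of `f`, this bounds the range of `f` by a constant times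
`K * log |V| / (1 - slem P)`. Hence, along a rapidly mixing sequence, the coordinates of the points
of a fiber vary by at most a polynomial in the logarithm of its size.

On the other hand, the fiber of `c * b` has at most `O(c ^ d)` points, while, as its relaxation is
`c` times a polytope of positive dimension, some coordinate varies by an amount linear in `c`.
-/

namespace FiberWalk

open Matrix

/-! ### Second largest eigenvalue moduli of symmetric matrices -/

theorem min_le_getD_one_sort {α : Type*} [LinearOrder α] {s : Multiset α} {a b : α}
    (h : {a, b} ≤ s) (z : α) : min a b ≤ (s.sort (· ≥ ·)).getD 1 z := by
  have hsort := s.pairwise_sort (· ≥ ·)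
  rw [← s.sort_eq (· ≥ ·)] at h
  generalize s.sort (· ≥ ·) = l at h hsort
  match l with
  | [] => simpa using Multiset.card_le_card h
  | [x] => simpa using Multiset.card_le_card h
  | x :: y :: t =>
    by_contra! hlt
    have htail : ∀ w ∈ y :: t, w < min a b := by
      rintro w (_ | ⟨_, hw⟩)
      · exact hlt
      · exact (List.rel_of_pairwise_cons hsort.of_cons hw).trans_lt hlt
    have hax : a = x := (List.mem_cons.1 (Multiset.mem_of_le h (by simp))).resolve_right
      fun ha => (htail a ha).not_ge (min_le_left a b)
    have hb : ({b} : Multiset α) ≤ (y :: t : List α) := by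
      rwa [Multiset.insert_eq_cons, hax, ← Multiset.cons_coe, Multiset.cons_le_cons_iff] at h
    exact (htail b (Multiset.singleton_le.1 hb)).not_ge (min_le_right a b)

section Slem

variable {V : Type} [Fintype V] [DecidableEq V] {S : Matrix V V ℝ}

theorem slem_nonneg (S : Matrix V V ℝ) : 0 ≤ slem S := by
  unfold slem
  rw [List.getD_eq_getElem?_getD]
  rcases h : (Multiset.sort _ _)[1]? with _ | a
  · simp
  · obtain ⟨z, -, rfl⟩ := Multiset.mem_map.1 ((Multiset.mem_sort _).1 (List.mem_of_getElem? h))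
    exact norm_nonneg z

theorem slem_eq_getD_one_sort_abs_eigenvalues (hS : S.IsHermitian) :
    slem S = ((Finset.univ.val.map fun i => |hS.eigenvalues i|).sort (· ≥ ·)).getD 1 0 := by
  have hsplits : S.charpoly.Splits := by
    rw [hS.charpoly_eq]
    exact Polynomial.Splits.prod fun i _ => Polynomial.Splits.X_sub_C _
  have hroots : (S.map fun x : ℝ => (x : ℂ)).charpoly.roots =
      S.charpoly.roots.map Complex.ofRealHom := by
    rw [← hsplits.roots_map, ← charpoly_map]
    rfl
  simp [slem, hroots, hS.roots_charpoly_eq_eigenvalues]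

theorem min_eigenvalues_le_slem (hS : S.IsHermitian) {i j : V} (hij : i ≠ j) :
    min (hS.eigenvalues i) (hS.eigenvalues j) ≤ slem S := by
  have hpair : ({i, j} : Multiset V) ≤ Finset.univ.val := by
    rw [Multiset.le_iff_subset (by simpa using hij)]
    exact fun x _ => Finset.mem_univ x
  rw [slem_eq_getD_one_sort_abs_eigenvalues hS]
  refine le_trans (min_le_min (le_abs_self _) (le_abs_self _)) (min_le_getD_one_sort ?_ 0)
  simpa using Multiset.map_le_map (f := fun k => |hS.eigenvalues k|) hpair

theorem exists_forall_ne_eigenvalues_le_slem [Nonempty V] (hS : S.IsHermitian) :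
    ∃ i₀, ∀ i ≠ i₀, hS.eigenvalues i ≤ slem S := by
  by_cases! h : ∃ i₀, slem S < hS.eigenvalues i₀
  · obtain ⟨i₀, hi₀⟩ := h
    exact ⟨i₀, fun i hi => (min_le_iff.1 (min_eigenvalues_le_slem hS hi)).resolve_right hi₀.not_ge⟩
  · exact ⟨Classical.arbitrary V, fun i _ => h i⟩

theorem exists_dotProduct_eq_sum_eigenvalues (hS : S.IsHermitian) :
    ∃ U : Matrix V V ℝ, ∀ w : V → ℝ, w ⬝ᵥ w = ∑ i, (U *ᵥ w) i ^ 2 ∧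
      w ⬝ᵥ S *ᵥ w = ∑ i, hS.eigenvalues i * (U *ᵥ w) i ^ 2 := by
  let U : Matrix V V ℝ := hS.eigenvectorUnitary
  have hU : U * Uᵀ = 1 := Unitary.mul_star_self_of_mem hS.eigenvectorUnitary.2
  have hSU : S = U * diagonal hS.eigenvalues * Uᵀ := hS.spectral_theorem
  refine ⟨Uᵀ, fun w => ⟨?_, ?_⟩⟩
  · calc w ⬝ᵥ w = w ⬝ᵥ (U * Uᵀ) *ᵥ w := by rw [hU, one_mulVec]
      _ = Uᵀ *ᵥ w ⬝ᵥ Uᵀ *ᵥ w := by rw [← mulVec_mulVec, dotProduct_mulVec, ← mulVec_transpose]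
      _ = _ := by simp [dotProduct, sq]
  · calc w ⬝ᵥ S *ᵥ w = w ⬝ᵥ (U * diagonal hS.eigenvalues * Uᵀ) *ᵥ w := by rw [← hSU]
      _ = Uᵀ *ᵥ w ⬝ᵥ diagonal hS.eigenvalues *ᵥ Uᵀ *ᵥ w := by
        rw [← mulVec_mulVec, ← mulVec_mulVec, dotProduct_mulVec, ← mulVec_transpose]
      _ = _ := by
        simp only [dotProduct, mulVec_diagonal]
        exact Finset.sum_congr rfl fun i _ => by ring

theorem exists_forall_dotProduct_mulVec_le_slem_mul [Nonempty V] (hS : S.IsHermitian) :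
    ∃ g : V → ℝ, ∀ w, g ⬝ᵥ w = 0 → w ⬝ᵥ S *ᵥ w ≤ slem S * (w ⬝ᵥ w) := by
  obtain ⟨i₀, hi₀⟩ := exists_forall_ne_eigenvalues_le_slem hS
  obtain ⟨U, hU⟩ := exists_dotProduct_eq_sum_eigenvalues hS
  refine ⟨U i₀, fun w hw => ?_⟩
  rw [(hU w).1, (hU w).2, Finset.mul_sum]
  refine Finset.sum_le_sum fun i _ => ?_
  rcases eq_or_ne i i₀ with rfl | hi
  · simp [show (U *ᵥ w) i = 0 from hw]
  · exact mul_le_mul_of_nonneg_right (hi₀ i hi) (sq_nonneg _)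

/-- Some nontrivial combination of `x` and `y` is orthogonal to the top eigenvector. -/
theorem lt_slem_of_orthogonal (hS : S.IsHermitian) {x y : V → ℝ} (hxy : x ⬝ᵥ y = 0)
    (hSxy : x ⬝ᵥ S *ᵥ y = 0) {c : ℝ} (hx : c * (x ⬝ᵥ x) < x ⬝ᵥ S *ᵥ x)
    (hy : c * (y ⬝ᵥ y) < y ⬝ᵥ S *ᵥ y) : c < slem S := by
  by_contra! hc
  have : Nonempty V := by
    by_contra! hV
    simp [dotProduct] at hx
  obtain ⟨g, hg⟩ := exists_forall_dotProduct_mulVec_le_slem_mul hS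
  have hgc : ∀ w, g ⬝ᵥ w = 0 → w ⬝ᵥ S *ᵥ w ≤ c * (w ⬝ᵥ w) := fun w hw =>
    (hg w hw).trans (mul_le_mul_of_nonneg_right hc (by simpa using dotProduct_star_self_nonneg w))
  have hgx : g ⬝ᵥ x ≠ 0 := fun h => (hgc x h).not_gt hx
  have hSyx : y ⬝ᵥ S *ᵥ x = 0 := by
    rw [← hSxy, dotProduct_comm, dotProduct_mulVec, ← mulVec_transpose,
      ← conjTranspose_eq_transpose_of_trivial, hS.eq]
  have hw := hgc ((g ⬝ᵥ y) • x - (g ⬝ᵥ x) • y) (by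
    simp only [dotProduct_sub, dotProduct_smul, smul_eq_mul]; ring)
  simp only [mulVec_sub, mulVec_smul, dotProduct_sub, sub_dotProduct, smul_dotProduct,
    dotProduct_smul, smul_eq_mul, hxy, hSxy, hSyx, dotProduct_comm y x] at hw
  nlinarith [mul_lt_mul_of_pos_left hy (sq_pos_of_ne_zero hgx),
    mul_le_mul_of_nonneg_left hx.le (sq_nonneg (g ⬝ᵥ y))]

end Slem

/-! ### Spread of a function along a symmetric random walk -/

section Indicator

variable {V : Type*} [Fintype V]

theorem indicator_dotProduct_mulVec_indicator (P : Matrix V V ℝ) (S T : Finset V) :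
    (S : Set V).indicator 1 ⬝ᵥ P *ᵥ (T : Set V).indicator 1 = ∑ u ∈ S, ∑ v ∈ T, P u v := by
  classical simp [dotProduct, mulVec, Set.indicator_apply]

variable [DecidableEq V]

theorem indicator_dotProduct_indicator (S T : Finset V) :
    (S : Set V).indicator (1 : V → ℝ) ⬝ᵥ (T : Set V).indicator 1 = (S ∩ T).card := by
  simp [dotProduct, Set.indicator_apply, Finset.inter_comm]

theorem card_le_sum_sum_of_mem_rowStochastic {P : Matrix V V ℝ} (hP : P ∈ rowStochastic ℝ V)
    {S T : Finset V} (hST : S ⊆ T) (h : ∀ u ∈ S, ∀ v, P u v ≠ 0 → v ∈ T) :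
    (S.card : ℝ) ≤ ∑ u ∈ T, ∑ v ∈ T, P u v := by
  have hrow : ∀ u ∈ S, ∑ v ∈ T, P u v = 1 := fun u hu => by
    rw [← sum_row_of_mem_rowStochastic hP u]
    exact Finset.sum_subset T.subset_univ fun v _ hv => of_not_not fun hne => hv (h u hu v hne)
  calc (S.card : ℝ) = ∑ u ∈ S, ∑ v ∈ T, P u v := by simp [Finset.sum_congr rfl hrow]
    _ ≤ _ := Finset.sum_le_sum_of_subset_of_nonneg hST fun u _ _ =>
      Finset.sum_nonneg fun v _ => nonneg_of_mem_rowStochastic hP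

end Indicator

section Spread

variable {V : Type} [Fintype V] [DecidableEq V] {P : Matrix V V ℝ}

theorem lt_slem_of_separated (hPH : P.IsHermitian) (hP : P ∈ rowStochastic ℝ V)
    {S₀ S₁ T₀ T₁ : Finset V} (hS : S₀ ⊆ S₁) (hT : T₀ ⊆ T₁)
    (hPS : ∀ u ∈ S₀, ∀ v, P u v ≠ 0 → v ∈ S₁) (hPT : ∀ u ∈ T₀, ∀ v, P u v ≠ 0 → v ∈ T₁)
    (hdisj : Disjoint S₁ T₁) (hST : ∀ u ∈ S₁, ∀ v ∈ T₁, P u v = 0) {c : ℝ}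
    (hcS : c * S₁.card < S₀.card) (hcT : c * T₁.card < T₀.card) : c < slem P := by
  apply lt_slem_of_orthogonal hPH (x := (S₁ : Set V).indicator 1) (y := (T₁ : Set V).indicator 1)
  · simp [indicator_dotProduct_indicator, Finset.disjoint_iff_inter_eq_empty.1 hdisj]
  · rw [indicator_dotProduct_mulVec_indicator]
    exact Finset.sum_eq_zero fun u hu => Finset.sum_eq_zero fun v hv => hST u hu v hv
  · rw [indicator_dotProduct_mulVec_indicator, indicator_dotProduct_indicator, Finset.inter_self]
    exact hcS.trans_le (card_le_sum_sum_of_mem_rowStochastic hP hS hPS)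
  · rw [indicator_dotProduct_mulVec_indicator, indicator_dotProduct_indicator, Finset.inter_self]
    exact hcT.trans_le (card_le_sum_sum_of_mem_rowStochastic hP hT hPT)

theorem card_sublevel_le_or_card_superlevel_le (hPH : P.IsHermitian) (hP : P ∈ rowStochastic ℝ V)
    {f : V → ℝ} {K : ℝ} (hK : 0 ≤ K) (hf : ∀ u v, P u v ≠ 0 → |f u - f v| ≤ K) {a b : ℝ}
    (hab : a + 3 * K < b) :
    ({u | f u ≤ a} : Finset V).card ≤ slem P * ({u | f u ≤ a + K} : Finset V).card ∨
      ({u | b ≤ f u} : Finset V).card ≤ slem P * ({u | b - K ≤ f u} : Finset V).card := by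
  by_contra! h
  refine (lt_slem_of_separated hPH hP ?_ ?_ ?_ ?_ ?_ ?_ h.1 h.2).false
  · exact Finset.monotone_filter_right _ fun u _ hu => by linarith
  · exact Finset.monotone_filter_right _ fun u _ hu => by linarith
  · intro u hu v huv
    rw [Finset.mem_filter_univ] at hu ⊢
    linarith [abs_le.1 (hf u v huv)]
  · intro u hu v huv
    rw [Finset.mem_filter_univ] at hu ⊢
    linarith [abs_le.1 (hf u v huv)]
  · exact Finset.disjoint_filter.2 fun u _ hu => by linarith
  · intro u hu v hv
    rw [Finset.mem_filter_univ] at hu hv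
    by_contra huv
    linarith [abs_le.1 (hf u v huv)]

/-- Either all sublevel sets around `x` or all superlevel sets around `y` grow geometrically. -/
theorem one_le_slem_pow_mul_card (hPH : P.IsHermitian) (hP : P ∈ rowStochastic ℝ V)
    {f : V → ℝ} {K : ℝ} (hK : 0 ≤ K) (hf : ∀ u v, P u v ≠ 0 → |f u - f v| ≤ K) {x y : V} {n : ℕ}
    (hn : (2 * n + 1) * K < f y - f x) : 1 ≤ slem P ^ n * Fintype.card V := by
  let S : ℕ → Finset V := fun r => {u | f u ≤ f x + r * K}
  let T : ℕ → Finset V := fun r => {u | f y - r * K ≤ f u}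
  have one_le_of_growth : ∀ A : ℕ → Finset V, (A 0).Nonempty →
      (∀ r < n, ((A r).card : ℝ) ≤ slem P * (A (r + 1)).card) →
      1 ≤ slem P ^ n * Fintype.card V := fun A hA h =>
    calc (1 : ℝ) ≤ (A 0).card := by exact_mod_cast hA.card_pos
      _ ≤ slem P ^ n * (A n).card := by
        simpa using le_geom (u := fun r => ((A (n - r)).card : ℝ)) (slem_nonneg P) n fun r hr => by
          rw [show n - r = n - (r + 1) + 1 by lia]
          exact h _ (by lia)
      _ ≤ slem P ^ n * Fintype.card V := by
        gcongr
        exacts [pow_nonneg (slem_nonneg P) n, (A n).card_le_univ]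
  have growth : ∀ r < n, ∀ s < n, ((S r).card : ℝ) ≤ slem P * (S (r + 1)).card ∨
      ((T s).card : ℝ) ≤ slem P * (T (s + 1)).card := fun r hr s hs => by
    have hr' : (r + 1) * K ≤ n * K := by gcongr; exact_mod_cast hr
    have hs' : (s + 1) * K ≤ n * K := by gcongr; exact_mod_cast hs
    convert card_sublevel_le_or_card_superlevel_le hPH hP hK hf
      (a := f x + r * K) (b := f y - s * K) (by linarith) using 5 <;>
    · simp only [S, T]
      push_cast
      ring_nf
  by_cases! hS : ∀ r < n, ((S r).card : ℝ) ≤ slem P * (S (r + 1)).card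
  · exact one_le_of_growth S ⟨x, by simp [S]⟩ hS
  · obtain ⟨r, hr, hlt⟩ := hS
    exact one_le_of_growth T ⟨y, by simp [T]⟩ fun s hs =>
      (growth r hr s hs).resolve_left hlt.not_ge

theorem sub_le_of_slem_le_one_sub (hPH : P.IsHermitian) (hP : P ∈ rowStochastic ℝ V)
    {f : V → ℝ} {K : ℝ} (hK : 0 ≤ K) (hf : ∀ u v, P u v ≠ 0 → |f u - f v| ≤ K) {q : ℝ}
    (hq : 0 < q) (hslem : slem P ≤ 1 - 1 / q) (x y : V) :
    f y - f x ≤ K * (2 * q * Real.log (Fintype.card V) + 3) := by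
  have : Nonempty V := ⟨x⟩
  by_contra! hlt
  set n : ℕ := ⌊q * Real.log (Fintype.card V)⌋₊ + 1
  have hfloor : (n : ℝ) ≤ q * Real.log (Fintype.card V) + 1 := by
    simpa [n] using Nat.floor_le (mul_nonneg hq.le (Real.log_natCast_nonneg _))
  have hone := one_le_slem_pow_mul_card hPH hP hK hf (x := x) (y := y) (n := n) (by
    rw [mul_comm]
    exact (mul_le_mul_of_nonneg_left (by linarith) hK).trans_lt hlt)
  have hexp : slem P ≤ Real.exp (-(1 / q)) := by linarith [Real.add_one_le_exp (-(1 / q))]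
  have hpow : 1 ≤ Real.exp (-(n / q)) * Fintype.card V :=
    calc 1 ≤ slem P ^ n * Fintype.card V := hone
      _ ≤ Real.exp (-(1 / q)) ^ n * Fintype.card V := by gcongr; exact slem_nonneg P
      _ = Real.exp (-(n / q)) * Fintype.card V := by rw [← Real.exp_nat_mul]; congr 2; ring
  have hlog : n / q ≤ Real.log (Fintype.card V) := by
    have := Real.log_nonneg hpow
    rw [Real.log_mul (Real.exp_ne_zero _) (by simp), Real.log_exp] at this
    linarith
  rw [div_le_iff₀' hq] at hlog
  exact hlog.not_gt (mod_cast Nat.lt_floor_add_one _)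

end Spread

/-! ### Fiber graphs -/

section FiberGraph

variable {d : ℕ}

theorem degree_fiberGraph (F M : Finset (Fin d → ℤ)) (u : F) :
    (fiberGraph F M).degree u = (plusMinus M).card := by
  have hneighbors : (F.filter fun v => u.1 - v ∈ plusMinus M).card =
      ((plusMinus M).filter fun e => u.1 + e ∈ F).card := by
    refine Finset.card_nbij' (fun v => v - u.1) (fun e => u.1 + e) ?_ ?_ ?_ ?_
    · intro v hv
      simp only [Finset.coe_filter, Set.mem_ofPred_eq] at hv ⊢
      exact ⟨by simpa using neg_mem_plusMinus hv.2, by simpa using hv.1⟩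
    · intro e he
      simp only [Finset.coe_filter, Set.mem_ofPred_eq] at he ⊢
      exact ⟨he.2, by simpa using neg_mem_plusMinus he.1⟩
    · exact fun v _ => add_sub_cancel u.1 v
    · exact fun e _ => add_sub_cancel_left u.1 e
  simp only [Multigraph.degree, fiberGraph, Finset.sum_add_distrib, Finset.sum_ite_eq,
    Finset.mem_univ, if_true]
  rw [Finset.sum_coe_sort F fun v => if u.1 - v ∈ plusMinus M then 1 else 0, ← Finset.card_filter,
    hneighbors, Finset.card_filter_add_card_filter_not]

theorem simpleWalk_fiberGraph_isHermitian (F M : Finset (Fin d → ℤ)) :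
    (fiberGraph F M).simpleWalk.IsHermitian :=
  IsHermitian.ext fun u v => by
    simp [Multigraph.simpleWalk, degree_fiberGraph, (fiberGraph F M).symm u v]

theorem simpleWalk_mem_rowStochastic {V : Type} [Fintype V] [DecidableEq V] {G : Multigraph V}
    (hG : ∀ v, G.degree v ≠ 0) : G.simpleWalk ∈ rowStochastic ℝ V := by
  refine mem_rowStochastic_iff_sum.2 ⟨fun u v => ?_, fun u => ?_⟩
  · simp only [Multigraph.simpleWalk, of_apply]
    positivity
  · simp only [Multigraph.simpleWalk, of_apply, ← Finset.sum_div, ← Nat.cast_sum]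
    exact div_self (Nat.cast_ne_zero.2 (hG u))

theorem simpleWalk_fiberGraph_mem_rowStochastic (F : Finset (Fin d → ℤ))
    {M : Finset (Fin d → ℤ)} (hM : M.Nonempty) :
    (fiberGraph F M).simpleWalk ∈ rowStochastic ℝ F :=
  simpleWalk_mem_rowStochastic fun u => by
    rw [degree_fiberGraph]
    exact (hM.mono Finset.subset_union_left).card_ne_zero

theorem eq_or_sub_mem_plusMinus_of_mult_ne_zero {F M : Finset (Fin d → ℤ)} {u v : F}
    (h : (fiberGraph F M).mult u v ≠ 0) : u = v ∨ u.1 - v.1 ∈ plusMinus M := by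
  contrapose! h
  simp [fiberGraph, h]

theorem abs_apply_le_of_mem_plusMinus {M : Finset (Fin d → ℤ)} {K : ℤ}
    (hK : ∀ e ∈ M, ∀ j, |e j| ≤ K) {e : Fin d → ℤ} (he : e ∈ plusMinus M) (j : Fin d) :
    |e j| ≤ K := by
  rcases Finset.mem_union.1 he with he | he
  · exact hK e he j
  · obtain ⟨e', he', rfl⟩ := Finset.mem_image.1 he
    simpa using hK e' he' j

theorem apply_sub_le_of_slem_fiberGraph_le {F M : Finset (Fin d → ℤ)} (hM : M.Nonempty) {K : ℤ}
    (hK : ∀ e ∈ M, ∀ j, |e j| ≤ K) {q : ℝ} (hq : 0 < q)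
    (hslem : slem (fiberGraph F M).simpleWalk ≤ 1 - 1 / q) {x y : Fin d → ℤ} (hx : x ∈ F)
    (hy : y ∈ F) (j : Fin d) : ((y j - x j : ℤ) : ℝ) ≤ K * (2 * q * Real.log F.card + 3) := by
  obtain ⟨e, he⟩ := hM
  have hK0 : 0 ≤ K := (abs_nonneg _).trans (hK e he j)
  have hstep : ∀ u v : F, (fiberGraph F M).simpleWalk u v ≠ 0 →
      |((u.1 j : ℤ) : ℝ) - ((v.1 j : ℤ) : ℝ)| ≤ K := fun u v huv => by
    have hmult : (fiberGraph F M).mult u v ≠ 0 := fun h => huv (by simp [Multigraph.simpleWalk, h])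
    rcases eq_or_sub_mem_plusMinus_of_mult_ne_zero hmult with rfl | hmem
    · simpa using hK0
    · exact_mod_cast abs_apply_le_of_mem_plusMinus hK hmem j
  simpa using sub_le_of_slem_le_one_sub (simpleWalk_fiberGraph_isHermitian F M)
    (simpleWalk_fiberGraph_mem_rowStochastic F ⟨e, he⟩) (mod_cast hK0) hstep hq hslem
    ⟨x, hx⟩ ⟨y, hy⟩

theorem monotoneOn_eval_of_coeff_nonneg {R : Type*} [CommSemiring R] [PartialOrder R]
    [IsOrderedRing R] {q : Polynomial R} (hq : ∀ n, 0 ≤ q.coeff n) :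
    MonotoneOn (fun t => q.eval t) (Set.Ici 0) := fun s hs t _ hst => by
  simp only [Polynomial.eval_eq_sum_range]
  exact Finset.sum_le_sum fun n _ =>
    mul_le_mul_of_nonneg_left (pow_le_pow_left₀ hs hst n) (hq n)

theorem RapidlyMixing.exists_polynomial_apply_sub_le {F : ℕ → Finset (Fin d → ℤ)}
    {M : Finset (Fin d → ℤ)} (hM : M.Nonempty)
    (h : RapidlyMixing fun i => fiberGraph (F i) M) :
    ∃ r : Polynomial ℝ, MonotoneOn r.eval (Set.Ici 0) ∧ ∀ i, ∀ x ∈ F i, ∀ y ∈ F i, ∀ j,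
      ((y j - x j : ℤ) : ℝ) ≤ r.eval (Real.log (F i).card) := by
  obtain ⟨q, hq, hmix⟩ := h
  obtain ⟨K, hK⟩ := (M.image fun e => ∑ j, |e j|).exists_le
  have hKM : ∀ e ∈ M, ∀ j, |e j| ≤ K := fun e he j =>
    (Finset.single_le_sum (fun j _ => abs_nonneg (e j)) (Finset.mem_univ j)).trans
      (hK _ (Finset.mem_image_of_mem _ he))
  have hK0 : (0 : ℝ) ≤ K := by
    obtain ⟨e, he⟩ := hM
    exact_mod_cast (Finset.sum_nonneg fun j _ => abs_nonneg (e j)).trans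
      (hK _ (Finset.mem_image_of_mem _ he))
  let r : Polynomial ℝ :=
    .C (K * 2 : ℝ) * (q.map (algebraMap ℚ ℝ) * .X) + .C (K * 3 : ℝ)
  have hr : ∀ n, 0 ≤ r.coeff n
    | 0 => by simpa [r] using hK0
    | n + 1 => by
      have : (0 : ℝ) ≤ q.coeff n := mod_cast hq n
      simp only [r, Polynomial.coeff_add, Polynomial.coeff_C_mul, Polynomial.coeff_mul_X,
        Polynomial.coeff_map, Polynomial.coeff_C_succ, eq_ratCast, add_zero]
      positivity
  refine ⟨r, monotoneOn_eval_of_coeff_nonneg hr, fun i x hx y hy j => ?_⟩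
  refine (apply_sub_le_of_slem_fiberGraph_le hM hKM (hmix i).1 (hmix i).2 hx hy j).trans_eq ?_
  simp only [r, Polynomial.eval_add, Polynomial.eval_mul, Polynomial.eval_C, Polynomial.eval_X,
    Polynomial.eval_map_algebraMap, Fintype.card_coe]
  ring

end FiberGraph

/-! ### Fibers of multiples of `b` -/

section Fiber

variable {m d : ℕ} {A : Matrix (Fin m) (Fin d) ℤ} {hA : TrivialNonnegKernel A} {b : Fin m → ℤ}

theorem mem_fiber {u : Fin d → ℤ} : u ∈ fiber A hA b ↔ 0 ≤ u ∧ A *ᵥ u = b := by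
  simp [fiber]

theorem nsmul_mem_fiber {u : Fin d → ℤ} (hu : u ∈ fiber A hA b) (n : ℕ) :
    n • u ∈ fiber A hA (n • b) :=
  mem_fiber.2 ⟨nsmul_nonneg (mem_fiber.1 hu).1 n, by rw [mulVec_smul, (mem_fiber.1 hu).2]⟩

theorem add_mem_fiber {u v : Fin d → ℤ} {c : Fin m → ℤ} (hu : u ∈ fiber A hA b)
    (hv : v ∈ fiber A hA c) : u + v ∈ fiber A hA (b + c) :=
  mem_fiber.2 ⟨add_nonneg (mem_fiber.1 hu).1 (mem_fiber.1 hv).1, by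
    rw [mulVec_add, (mem_fiber.1 hu).2, (mem_fiber.1 hv).2]⟩

theorem eq_zero_of_mem_fiber_zero {u : Fin d → ℤ} (hu : u ∈ fiber A hA 0) : u = 0 :=
  hA u (mem_fiber.1 hu).2 (mem_fiber.1 hu).1

theorem fiber_nonempty_iff : (fiber A hA b).Nonempty ↔ b ∈ affineSemigroup A := by
  rw [affineSemigroup, AddSubmonoid.mem_closure_range_iff_of_fintype]
  have hsum (a : Fin d → ℕ) : ∑ j, a j • (fun i => A i j) = A *ᵥ fun j => (a j : ℤ) := by
    ext i
    simp [mulVec, dotProduct, mul_comm]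
  simp only [hsum]
  constructor
  · rintro ⟨u, hu⟩
    obtain ⟨hu0, hub⟩ := mem_fiber.1 hu
    lift u to Fin d → ℕ using hu0
    exact ⟨u, hub.symm⟩
  · rintro ⟨a, rfl⟩
    exact ⟨fun j => a j, mem_fiber.2 ⟨fun j => Int.natCast_nonneg _, rfl⟩⟩

theorem exists_natCast_mul_eq_intCast {ι : Type*} [Finite ι] (x : ι → ℚ) :
    ∃ n : ℕ, 0 < n ∧ ∃ z : ι → ℤ, ∀ i, (z i : ℚ) = n * x i := by
  cases nonempty_fintype ι
  refine ⟨∏ i, (x i).den, Finset.prod_pos fun i _ => (x i).den_pos, ?_⟩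
  choose k hk using fun i => Finset.dvd_prod_of_mem (fun i => (x i).den) (Finset.mem_univ i)
  refine ⟨fun i => k i * (x i).num, fun i => ?_⟩
  rw [hk i]
  push_cast
  rw [← Rat.den_mul_eq_num]
  ring

theorem mem_fiber_nsmul_of_mem_relaxedFiber {n : ℕ} {x : Fin d → ℚ} {u : Fin d → ℤ}
    (hx : x ∈ relaxedFiber A b) (hu : ∀ j, (u j : ℚ) = n * x j) : u ∈ fiber A hA (n • b) := by
  refine mem_fiber.2 ⟨fun j => ?_, funext fun i => ?_⟩
  · have : (0 : ℚ) ≤ u j := hu j ▸ mul_nonneg n.cast_nonneg (hx.1 j)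
    exact_mod_cast this
  · refine Int.cast_injective (α := ℚ) ?_
    calc ((A *ᵥ u) i : ℚ) = (A.map (fun z : ℤ => (z : ℚ)) *ᵥ fun j => (u j : ℚ)) i :=
          (Int.castRingHom ℚ).map_mulVec A u i
      _ = (A.map (fun z : ℤ => (z : ℚ)) *ᵥ (n : ℚ) • x) i := by rw [funext hu]; rfl
      _ = n * b i := by rw [mulVec_smul, hx.2]; rfl
      _ = ((n • b) i : ℤ) := by simp

theorem nontrivial_of_affineDim_pos {P : Set (Fin d → ℚ)} (hP : 0 < affineDim P) :
    P.Nontrivial := by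
  contrapose! hP
  rcases hP.eq_empty_or_singleton with rfl | ⟨x, rfl⟩ <;>
    simp [affineDim, direction_affineSpan]

theorem exists_mem_fiber_nsmul_apply_lt (hdim : 0 < affineDim (relaxedFiber A b)) :
    ∃ n : ℕ, 0 < n ∧ ∃ x ∈ fiber A hA (n • b), ∃ y ∈ fiber A hA (n • b), ∃ j, x j < y j := by
  obtain ⟨x, hx, y, hy, hxy⟩ := nontrivial_of_affineDim_pos hdim
  obtain ⟨n, hn, z, hz⟩ := exists_natCast_mul_eq_intCast (Sum.elim x y)
  have hX := mem_fiber_nsmul_of_mem_relaxedFiber (hA := hA) hx fun j => hz (.inl j)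
  have hY := mem_fiber_nsmul_of_mem_relaxedFiber (hA := hA) hy fun j => hz (.inr j)
  obtain ⟨j, hj⟩ := Function.ne_iff.1 hxy
  have hne : z (.inl j) ≠ z (.inr j) := by
    rw [← Int.cast_injective (α := ℚ).ne_iff, hz, hz]
    simpa [hn.ne'] using hj
  rcases hne.lt_or_gt with hlt | hlt
  · exact ⟨n, hn, _, hX, _, hY, j, hlt⟩
  · exact ⟨n, hn, _, hY, _, hX, j, hlt⟩

theorem ne_zero_of_affineDim_relaxedFiber_pos (hA : TrivialNonnegKernel A)
    (hdim : 0 < affineDim (relaxedFiber A b)) : b ≠ 0 := by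
  rintro rfl
  obtain ⟨n, -, x, hx, y, hy, j, hj⟩ := exists_mem_fiber_nsmul_apply_lt (hA := hA) hdim
  rw [smul_zero] at hx hy
  simp [eq_zero_of_mem_fiber_zero hx, eq_zero_of_mem_fiber_zero hy] at hj

/-- The pairs `(u, t)` with `A u = t b` form a finitely generated monoid whose generators have
`t ≠ 0` unless `u = 0`. -/
theorem exists_forall_mem_fiber_nsmul_apply_le (hA : TrivialNonnegKernel A) (b : Fin m → ℤ) :
    ∃ C : ℕ, ∀ t : ℕ, ∀ u ∈ fiber A hA (t • b), ∀ j, u j ≤ C * t := by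
  let f : (Fin d → ℕ) × ℕ →+ (Fin m → ℤ) :=
    A.mulVecLin.toAddMonoidHom.comp
      (((Nat.castAddMonoidHom ℤ).compLeft (Fin d)).comp (AddMonoidHom.fst _ _))
  let g : (Fin d → ℕ) × ℕ →+ (Fin m → ℤ) :=
    (multiplesHom (Fin m → ℤ) b).comp (AddMonoidHom.snd _ _)
  have hmem : ∀ w, w ∈ f.eqLocusM g ↔ (fun j => (w.1 j : ℤ)) ∈ fiber A hA (w.2 • b) := fun w => by
    have hw : (0 : Fin d → ℤ) ≤ fun j => (w.1 j : ℤ) := fun j => Int.natCast_nonneg (w.1 j)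
    rw [mem_fiber, and_iff_right hw]
    rfl
  obtain ⟨S, hS⟩ := AddSubmonoid.fg_eqLocusM f g
  obtain ⟨C, hC⟩ := (S.image fun s => ∑ j, s.1 j).exists_le
  have hgen : ∀ s ∈ S, ∀ j, s.1 j ≤ C * s.2 := fun s hs j => by
    rcases Nat.eq_zero_or_pos s.2 with h0 | hpos
    · have hs' := (hmem s).1 (hS ▸ AddSubmonoid.subset_closure hs)
      rw [h0, zero_smul] at hs'
      have := congrFun (eq_zero_of_mem_fiber_zero hs') j
      simp only [Pi.zero_apply, Nat.cast_eq_zero] at this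
      simp [this]
    · calc s.1 j ≤ ∑ j, s.1 j := Finset.single_le_sum (by simp) (Finset.mem_univ j)
        _ ≤ C := hC _ (Finset.mem_image_of_mem _ hs)
        _ ≤ C * s.2 := Nat.le_mul_of_pos_right _ hpos
  have hspan : ∀ w ∈ AddSubmonoid.closure (S : Set ((Fin d → ℕ) × ℕ)), ∀ j, w.1 j ≤ C * w.2 := by
    intro w hw j
    induction hw using AddSubmonoid.closure_induction with
    | zero => simp
    | add v w _ _ hv hw => simpa [mul_add] using add_le_add hv hw
    | mem s hs => exact hgen s hs j
  refine ⟨C, fun t u hu j => ?_⟩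
  have hu0 := (mem_fiber.1 hu).1
  lift u to Fin d → ℕ using hu0
  have hle : u j ≤ C * t := hspan (u, t) (hS ▸ (hmem (u, t)).2 hu) j
  simpa using (Nat.cast_le (α := ℤ)).2 hle

theorem exists_card_fiber_le_pow (hA : TrivialNonnegKernel A) (b : Fin m → ℤ) {Q : ℕ}
    (hQ : 0 < Q) :
    ∃ C : ℕ, ∀ (t : ℕ) (b' : Fin m → ℤ), Q • b' = t • b →
      (fiber A hA b').card ≤ (C * t + 1) ^ d := by
  obtain ⟨C, hC⟩ := exists_forall_mem_fiber_nsmul_apply_le hA b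
  refine ⟨C, fun t b' hb' => ?_⟩
  have hsub : fiber A hA b' ⊆ Fintype.piFinset fun _ => Finset.Icc 0 (C * t : ℤ) := fun u hu =>
    Fintype.mem_piFinset.2 fun j => Finset.mem_Icc.2 ⟨(mem_fiber.1 hu).1 j,
      calc u j ≤ Q * u j := le_mul_of_one_le_left ((mem_fiber.1 hu).1 j) (mod_cast hQ)
        _ = (Q • u) j := by simp
        _ ≤ C * t := hC t _ (hb' ▸ nsmul_mem_fiber hu Q) j⟩
  have hcard : (C * t + 1 : ℤ).toNat = C * t + 1 := mod_cast Int.toNat_natCast (C * t + 1)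
  simpa [hcard] using Finset.card_le_card hsub

theorem exists_log_card_fiber_le (hA : TrivialNonnegKernel A) (b : Fin m → ℤ) {Q : ℕ}
    (hQ : 0 < Q) :
    ∃ C : ℝ, ∀ (t : ℕ) (b' : Fin m → ℤ), 0 < t → Q • b' = t • b →
      Real.log (fiber A hA b').card ≤ d * (C + Real.log t) := by
  obtain ⟨C, hC⟩ := exists_card_fiber_le_pow hA b hQ
  refine ⟨Real.log (C + 1 : ℕ), fun t b' ht hb' => ?_⟩
  have hcard : (fiber A hA b').card ≤ ((C + 1) * t) ^ d :=
    (hC t b' hb').trans (Nat.pow_le_pow_left (by lia) d)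
  rw [← Real.log_mul (by positivity) (by positivity), ← Real.log_pow]
  rcases (fiber A hA b').card.eq_zero_or_pos with h0 | hpos
  · simpa [h0] using Real.log_natCast_nonneg (((C + 1) * t) ^ d)
  · exact Real.log_le_log (mod_cast hpos) (mod_cast hcard)

theorem exists_forall_mem_exists_le_modEq (S : Set ℕ) {L : ℕ} (hL : 0 < L) :
    ∃ B, ∀ n ∈ S, ∃ n' ∈ S, n' ≤ B ∧ n' ≡ n [MOD L] := by
  obtain ⟨S', hS', hbij⟩ := S.exists_subset_bijOn (· % L)
  have hfin : ((· % L) '' S).Finite :=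
    (Set.finite_Iio L).subset (Set.image_subset_iff.2 fun n _ => Nat.mod_lt n hL)
  obtain ⟨B, hB⟩ := (hbij.finite_iff_finite.2 hfin).bddAbove
  refine ⟨B, fun n hn => ?_⟩
  obtain ⟨n', hn', hmod⟩ := hbij.surjOn (Set.mem_image_of_mem _ hn)
  exact ⟨n', hS' hn', hB hn', hmod⟩

/-- Once one fiber `F(b₀)` with `Q b₀ = t₀ b` is nonempty, the fibers in the residue class of `t₀`
contain translates of the segments `[k x, k y]` with `x, y ∈ F(n b)`. -/
theorem exists_le_add_mul_apply_sub (hA : TrivialNonnegKernel A)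
    (hdim : 0 < affineDim (relaxedFiber A b)) {Q : ℕ} (hQ : 0 < Q) :
    ∃ (B L : ℕ) (j : Fin d), ∀ (t : ℕ) (b' : Fin m → ℤ), b' ∈ affineSemigroup A →
      Q • b' = t • b →
        ∃ x ∈ fiber A hA b', ∃ y ∈ fiber A hA b', (t : ℤ) ≤ B + L * (y j - x j) := by
  obtain ⟨n, hn, x, hx, y, hy, j, hxy⟩ := exists_mem_fiber_nsmul_apply_lt (hA := hA) hdim
  obtain ⟨B, hB⟩ := exists_forall_mem_exists_le_modEq
    {t | ∃ b' ∈ affineSemigroup A, Q • b' = t • b} (Nat.mul_pos hQ hn)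
  refine ⟨B, Q * n, j, fun t b' hb' ht => ?_⟩
  rcases le_or_gt t B with htB | htB
  · obtain ⟨u, hu⟩ := (fiber_nonempty_iff (hA := hA)).2 hb'
    exact ⟨u, hu, u, hu, by simpa using htB⟩
  · obtain ⟨t₀, ⟨b₀, hb₀, ht₀⟩, ht₀B, hmod⟩ := hB t ⟨b', hb', ht⟩
    obtain ⟨u, hu⟩ := (fiber_nonempty_iff (hA := hA)).2 hb₀
    obtain ⟨k, hk⟩ := (Nat.modEq_iff_dvd' (ht₀B.trans htB.le)).1 hmod
    have htk : t = t₀ + Q * n * k := by lia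
    have hb'k : b₀ + k • n • b = b' := by
      refine smul_right_injective _ hQ.ne' (?_ : Q • (b₀ + k • n • b) = Q • b')
      rw [ht, smul_add, ht₀, htk, add_smul, mul_smul, mul_smul, smul_comm k n b, smul_comm n k b]
    refine ⟨u + k • x, hb'k ▸ add_mem_fiber hu (nsmul_mem_fiber hx k),
      u + k • y, hb'k ▸ add_mem_fiber hu (nsmul_mem_fiber hy k), ?_⟩
    have hwidth : (k : ℤ) ≤ (u + k • y) j - (u + k • x) j := by
      rw [Pi.add_apply, Pi.add_apply, Pi.smul_apply, Pi.smul_apply, nsmul_eq_mul, nsmul_eq_mul]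
      nlinarith
    calc (t : ℤ) = t₀ + (Q * n : ℕ) * k := by rw [htk]; push_cast; ring
      _ ≤ _ := by gcongr

end Fiber

section Multiples

variable {m d : ℕ} {A : Matrix (Fin m) (Fin d) ℤ} {b : Fin m → ℤ}

theorem exists_nsmul_eq_nsmul_of_not_bddAbove (hb : b ≠ 0) {ι : Type*} {bs : ι → Fin m → ℤ}
    (hbs : ¬ BddAbove {c : ℚ | ∃ i, ∀ j, (bs i j : ℚ) = c * b j}) :
    ∃ Q > 0, ∀ T : ℕ, ∃ t > T, ∃ i, Q • bs i = t • b := by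
  obtain ⟨j₀, hj₀⟩ := Function.ne_iff.1 hb
  have hQ : 0 < (b j₀).natAbs := Int.natAbs_pos.2 hj₀
  refine ⟨(b j₀).natAbs, hQ, fun T => ?_⟩
  obtain ⟨c, ⟨i, hi⟩, hc⟩ := not_bddAbove_iff.1 hbs T
  have hc0 : 0 < c := T.cast_nonneg.trans_lt hc
  have ht : ((bs i j₀).natAbs : ℚ) = (b j₀).natAbs * c := by
    rw [Nat.cast_natAbs, Nat.cast_natAbs, Int.cast_abs, Int.cast_abs, hi j₀, abs_mul,
      abs_of_pos hc0, mul_comm]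
  refine ⟨(bs i j₀).natAbs, ?_, i, funext fun j => ?_⟩
  · have : (T : ℚ) < (bs i j₀).natAbs := by
      rw [ht]
      exact hc.trans_le (le_mul_of_one_le_left hc0.le (mod_cast hQ))
    exact_mod_cast this
  · have : ((b j₀).natAbs : ℚ) * bs i j = (bs i j₀).natAbs * b j := by
      rw [ht, hi j, mul_assoc]
    exact Int.cast_injective (α := ℚ) (by simpa using this)

theorem eq_zero_of_add_eq_zero_of_mem_affineSemigroup (hA : TrivialNonnegKernel A)
    {x y : Fin m → ℤ} (hx : x ∈ affineSemigroup A) (hy : y ∈ affineSemigroup A)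
    (hxy : x + y = 0) : x = 0 := by
  obtain ⟨u, hu⟩ := (fiber_nonempty_iff (hA := hA)).2 hx
  obtain ⟨v, hv⟩ := (fiber_nonempty_iff (hA := hA)).2 hy
  have huv : u + v = 0 := eq_zero_of_mem_fiber_zero (hxy ▸ add_mem_fiber hu hv)
  have hu0 : u = 0 :=
    ((add_eq_zero_iff_of_nonneg (mem_fiber.1 hu).1 (mem_fiber.1 hv).1).1 huv).1
  rw [← (mem_fiber.1 hu).2, hu0, mulVec_zero]

theorem nonneg_of_mem_affineSemigroup (hA : TrivialNonnegKernel A) (hb : b ∈ affineSemigroup A)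
    (hb0 : b ≠ 0) {b' : Fin m → ℤ} (hb' : b' ∈ affineSemigroup A) {c : ℚ}
    (hc : ∀ j, (b' j : ℚ) = c * b j) : 0 ≤ c := by
  by_contra! hneg
  have hnum : (c.num.natAbs : ℚ) = -c.num := by
    rw [Nat.cast_natAbs, abs_of_neg (Rat.num_neg.2 hneg), Int.cast_neg]
  have hsum : c.num.natAbs • b + c.den • b' = 0 := funext fun j => by
    have : (c.num.natAbs : ℚ) * b j + c.den * b' j = 0 := by
      rw [hnum, hc j, ← mul_assoc, Rat.den_mul_eq_num]
      ring
    exact Int.cast_injective (α := ℚ) (by simpa using this)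
  have hzero := eq_zero_of_add_eq_zero_of_mem_affineSemigroup hA (nsmul_mem hb _)
    (nsmul_mem hb' _) hsum
  exact (smul_ne_zero (Int.natAbs_ne_zero.2 (Rat.num_neg.2 hneg).ne) hb0) hzero

theorem not_bddAbove_setOf_eq_mul (hA : TrivialNonnegKernel A) (hb : b ∈ affineSemigroup A)
    (hb0 : b ≠ 0) {bs : ℕ → Fin m → ℤ} (hbs : ∀ i, bs i ∈ affineSemigroup A) {p : Polynomial ℚ}
    (hp : 0 < p.natDegree) {φ : ℕ → ℕ} (hφ : ∀ k j, (bs (φ k) j : ℚ) = p.eval (k : ℚ) * b j) :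
    ¬ BddAbove {c : ℚ | ∃ i, ∀ j, (bs i j : ℚ) = c * b j} := by
  rintro ⟨B, hB⟩
  have htendsto := (p.abs_tendsto_atTop (Polynomial.natDegree_pos_iff_degree_pos.1 hp)).comp
    (tendsto_natCast_atTop_atTop (R := ℚ))
  obtain ⟨k, hk⟩ := (htendsto.eventually_gt_atTop B).exists
  rw [Function.comp_apply, abs_of_nonneg
    (nonneg_of_mem_affineSemigroup hA hb hb0 (hbs (φ k)) (hφ k))] at hk
  exact (hB ⟨φ k, hφ k⟩).not_gt hk

end Multiples

theorem eventually_eval_log_lt (r : Polynomial ℝ) :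
    ∀ᶠ t : ℝ in Filter.atTop, r.eval (Real.log t) < t := by
  have hlittle : (fun t : ℝ => r.eval (Real.log t)) =o[Filter.atTop] (id : ℝ → ℝ) := by
    simp only [Polynomial.eval_eq_sum_range]
    exact .fun_sum fun i _ => Real.isLittleO_pow_log_id_atTop.const_mul_left _
  filter_upwards [hlittle.bound one_half_pos, Filter.eventually_gt_atTop 0] with t ht ht0
  rw [id, Real.norm_of_nonneg ht0.le] at ht
  linarith [Real.le_norm_self (r.eval (Real.log t))]

theorem IsMarkovBasis.nonempty {m d : ℕ} {A : Matrix (Fin m) (Fin d) ℤ}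
    {hA : TrivialNonnegKernel A} {M : Finset (Fin d → ℤ)} (hM : IsMarkovBasis A hA M)
    {b : Fin m → ℤ} (hdim : 0 < affineDim (relaxedFiber A b)) : M.Nonempty := by
  obtain ⟨n, -, x, hx, y, hy, j, hxy⟩ := exists_mem_fiber_nsmul_apply_lt (hA := hA) hdim
  by_contra! hempty
  subst hempty
  have hpath := (hM.2 _ (fiber_nonempty_iff.1 ⟨x, hx⟩)).2 ⟨x, hx⟩ ⟨y, hy⟩
  rcases hpath.cases_head with h | ⟨z, hz, -⟩
  · exact hxy.ne (congrArg (fun w => w.1 j) h)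
  · simp [fiberGraph, plusMinus] at hz

end FiberWalk

theorem corollaryc_general {m d : ℕ} (A : Matrix (Fin m) (Fin d) ℤ)
    (hA : FiberWalk.TrivialNonnegKernel A) (M : Finset (Fin d → ℤ)) (hM : M.Nonempty)
    (b : Fin m → ℤ) (hdim : 0 < FiberWalk.affineDim (FiberWalk.relaxedFiber A b))
    (bs : ℕ → Fin m → ℤ) (hbs : ∀ i, bs i ∈ FiberWalk.affineSemigroup A)
    (hunbdd : ¬ BddAbove {c : ℚ | ∃ i, ∀ j, (bs i j : ℚ) = c * b j}) :
    ¬ FiberWalk.RapidlyMixing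
      (fun i => FiberWalk.fiberGraph (FiberWalk.fiber A hA (bs i)) M) := by
  intro hmix
  obtain ⟨r, hr, hwidth⟩ := hmix.exists_polynomial_apply_sub_le hM
  obtain ⟨Q, hQ, hlarge⟩ := FiberWalk.exists_nsmul_eq_nsmul_of_not_bddAbove
    (FiberWalk.ne_zero_of_affineDim_relaxedFiber_pos hA hdim) hunbdd
  obtain ⟨B, L, j, hspread⟩ := FiberWalk.exists_le_add_mul_apply_sub hA hdim hQ
  obtain ⟨C, hcard⟩ := FiberWalk.exists_log_card_fiber_le hA b hQ
  obtain ⟨T, hT⟩ := Filter.eventually_atTop.1 <| tendsto_natCast_atTop_atTop.eventually <|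
    FiberWalk.eventually_eval_log_lt (.C (B : ℝ) + .C (L : ℝ) * r.comp (.C (d : ℝ) * (.C C + .X)))
  obtain ⟨t, htT, i, hi⟩ := hlarge T
  obtain ⟨x, hx, y, hy, hxy⟩ := hspread t (bs i) (hbs i) hi
  have hlog := hcard t (bs i) (T.zero_le.trans_lt htT) hi
  have hmono := hr (Real.log_natCast_nonneg _) ((Real.log_natCast_nonneg _).trans hlog) hlog
  refine (hT t htT.le).not_ge ?_
  simp only [Polynomial.eval_add, Polynomial.eval_mul, Polynomial.eval_comp, Polynomial.eval_C,
    Polynomial.eval_X]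
  calc (t : ℝ) ≤ B + L * ((y j - x j : ℤ) : ℝ) := mod_cast hxy
    _ ≤ _ := by gcongr; exact (hwidth i x hx y hy j).trans hmono

theorem corollaryc {m d : ℕ} (A : Matrix (Fin m) (Fin d) ℤ)
    (hA : FiberWalk.TrivialNonnegKernel A)
    (M : Finset (Fin d → ℤ)) (hM : FiberWalk.IsMarkovBasis A hA M)
    (b : Fin m → ℤ) (hb : b ∈ FiberWalk.affineSemigroup A)
    (hdim : 0 < FiberWalk.affineDim (FiberWalk.relaxedFiber A b))
    (bs : ℕ → Fin m → ℤ) (hbs : ∀ i, bs i ∈ FiberWalk.affineSemigroup A)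
    (p : Polynomial ℚ) (hp : 0 < p.natDegree)
    (hsub : ∃ φ : ℕ → ℕ, StrictMono φ ∧
      ∀ k : ℕ, ∀ j : Fin m, ((bs (φ k) j : ℤ) : ℚ) = p.eval (k : ℚ) * (b j : ℚ)) :
    ¬ FiberWalk.RapidlyMixing
      (fun i => FiberWalk.fiberGraph (FiberWalk.fiber A hA (bs i)) M) := by
  obtain ⟨φ, -, hφ⟩ := hsub
  exact corollaryc_general A hA M (hM.nonempty hdim) b hdim bs hbs
    (FiberWalk.not_bddAbove_setOf_eq_mul hA hb
      (FiberWalk.ne_zero_of_affineDim_relaxedFiber_pos hA hdim) hbs hp hφ)
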